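/- Let $(W,S)$ be a Coxeter group with length function $\ell$, and let $K$ be a commutative ring with a unit $t\in K^\times$ (for example $K=\mathbb{Q}(t)$). Let $\mathcal{H}$ be the Iwahori–Hecke algebra of $W$ over $K$, that is, the free $K$-module with basis $(T_w)_{w\in W}$ and the associative multiplication such that, for $s\in S$ and $w\in W$, $T_sT_w=T_{sw}$ if $\ell(sw)>\ell(w)$ and $T_sT_w=t^2T_{sw}+(t^2-1)T_w$ if $\ell(sw)<\ell(w)$. Let ${}^*$ be the $K$-linear map $\mathcal{H}\to\mathcal{H}$ with $T_w^*=T_{w^{-1}}$. Let $C'_w=t^{-\ell(w)}\sum_{y\le w}P_{y,w}(t^2)T_y$ $(w\in W)$ be the Kazhdan–Lusztig basis of $\mathcal{H}$ (it is defined over $\mathbb{Z}[t,t^{-1}]$ and specialized to $K$); in particular $C'_s=t^{-1}(T_s+1)$ for $s\in S$. For $w\in W$ let $L(w)=\{s\in S:\ell(sw)<\ell(w)\}$ be its left descent set. Let $\le_L$ be the Kazhdan–Lusztig left preorder on $W$, that is, the reflexive transitive closure of the relation "$\mu(x,w)\neq0$ or $\mu(w,x)\ne0$, and $L(x)\not\subseteq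 L(w)$", where $\mu(x,w)$ is the coefficient of $q^{(\ell(w)-\ell(x)-1)/2}$ in $P_{x,w}(q)$ if $x<w$ and $0$ otherwise. Let $\mathcal{C}\subseteq W$ be a left cell, i.e. an equivalence class for the relation "$x\le_L w$ and $w\le_L x$". Let $M_{\mathcal{C}}$ be the left cell representation: the left ideal generated by the $C'_y$ with $y\le_L w$ for some $w\in\mathcal{C}$, modulo the left ideal generated by those of these $C'_y$ with $y\notin\mathcal{C}$. For $x\in\mathcal{C}$ let $c_x\in M_{\mathcal{C}}$ be the class of $C'_x$. Theorem. Let $\langle\ ,\ \rangle$ be a nondegenerate symmetric $K$-bilinear form on $M_{\mathcal{C}}$ that is invariant, in the sense that $\langle T_wv,v'\rangle=\langle v,T_w^*v'\rangle$ for all $w\in W$ and $v,v'\in M_{\mathcal{C}}$. Let $s\in S$ be a simple reflection. Then for every pair $x,w\in\mathcal{C}$ with $s\in L(x)$ and $s\notin L(w)$, \[(t+t^{-1})\,\langle c_x,c_w\rangle=\langle c_x,\,C'_s\,c_w\rangle.\] -/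

import Mathlib

namespace CoxeterSystem

variable {B W : Type*} [Group W] {M : CoxeterMatrix B} (cs : CoxeterSystem M W)

open Classical in
/-- Auxiliary operator used to prove the exchange property. -/
noncomputable def signStep (i : B) : Function.End (W × ZMod 2) :=
  fun p => (cs.simple i * p.1 * cs.simple i, p.2 + if p.1 = cs.simple i then 1 else 0)

theorem signStep_isLiftable : M.IsLiftable cs.signStep := by
  classical
  intro i j
  set g := cs.simple i * cs.simple j with hg
  have key : ∀ (n : ℕ) (p : W × ZMod 2), ((cs.signStep i * cs.signStep j) ^ n) p =
      (g ^ n * p.1 * (g ^ n)⁻¹,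
        p.2 + ∑ k ∈ Finset.range (2 * n), if p.1 = cs.simple j * g ^ k then 1 else 0) := by
    intro n
    induction n with
    | zero => intro p; simp; rfl
    | succ n ih =>
      intro p
      have hginv : g⁻¹ = cs.simple j * cs.simple i := by simp [hg]
      have hc : ∀ k : ℕ, (g ^ k)⁻¹ * cs.simple j = cs.simple j * g ^ k := by
        intro k
        induction k with
        | zero => simp
        | succ k ihk =>
          rw [pow_succ, mul_inv_rev, mul_assoc, ihk, hginv, ← pow_succ, pow_succ']
          simp [hg, mul_assoc]
      rw [pow_succ']
      change (cs.signStep i) (cs.signStep j (((cs.signStep i * cs.signStep j) ^ n) p)) = _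
      rw [ih]
      have e1 : (g ^ n * p.1 * (g ^ n)⁻¹ = cs.simple j) ↔ p.1 = cs.simple j * g ^ (2 * n) := by
        rw [mul_inv_eq_iff_eq_mul, ← eq_inv_mul_iff_mul_eq, ← mul_assoc, hc, mul_assoc, ← pow_add,
          two_mul]
      have e2 : (cs.simple j * (g ^ n * p.1 * (g ^ n)⁻¹) * cs.simple j = cs.simple i) ↔
          p.1 = cs.simple j * g ^ (2 * n + 1) := by
        have : cs.simple j * (g ^ n * p.1 * (g ^ n)⁻¹) * cs.simple j = cs.simple i ↔
            g ^ n * p.1 * (g ^ n)⁻¹ = cs.simple j * g := by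
          generalize g ^ n * p.1 * (g ^ n)⁻¹ = y
          constructor
          · intro h
            rw [hg, ← h]; simp [mul_assoc]
          · intro h
            rw [h, hg]; simp [mul_assoc]
        rw [this, mul_inv_eq_iff_eq_mul, ← eq_inv_mul_iff_mul_eq, ← mul_assoc, ← mul_assoc, hc,
          mul_assoc, mul_assoc, ← pow_succ', ← pow_add]
        congr! 3
        omega
      rw [show 2 * (n + 1) = 2 * n + 1 + 1 by ring, Finset.sum_range_succ, Finset.sum_range_succ]
      simp only [signStep, e1, e2]
      ext1
      · simp [pow_succ', mul_assoc, hg]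
      · simp [add_assoc]
  funext p
  rw [key]
  have hm : g ^ M i j = 1 := cs.simple_mul_simple_pow i j
  rw [two_mul, Finset.sum_range_add]
  simp only [pow_add, hm, one_mul, inv_one, mul_one]
  rw [CharTwo.add_self_eq_zero, add_zero]
  rfl

theorem signStep_prod (ω : List B) (p : W × ZMod 2) [DecidableEq W] :
    cs.lift ⟨cs.signStep, cs.signStep_isLiftable⟩ (cs.wordProd ω) p =
      (cs.wordProd ω * p.1 * (cs.wordProd ω)⁻¹, p.2 + (cs.rightInvSeq ω).count p.1) := by
  induction ω with
  | nil => simp; rfl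
  | cons i ω ih =>
    rw [wordProd_cons, map_mul, lift_apply_simple]
    change cs.signStep i (cs.lift ⟨cs.signStep, cs.signStep_isLiftable⟩ (cs.wordProd ω) p) = _
    rw [ih]
    have e : (cs.wordProd ω * p.1 * (cs.wordProd ω)⁻¹ = cs.simple i) ↔
        (cs.wordProd ω)⁻¹ * cs.simple i * cs.wordProd ω = p.1 := by
      rw [mul_inv_eq_iff_eq_mul, ← eq_inv_mul_iff_mul_eq, mul_assoc, eq_comm]
    simp only [signStep, e, rightInvSeq, List.count_cons]
    ext1
    · simp [mul_assoc]
    · simp [add_assoc]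

theorem mem_rightInvSeq_of_isRightDescent {ω : List B} {i : B}
    (h : cs.IsRightDescent (cs.wordProd ω) i) : cs.simple i ∈ cs.rightInvSeq ω := by
  classical
  obtain ⟨ω', hr, hw⟩ := cs.exists_isReduced (cs.wordProd ω * cs.simple i)
  have hω : cs.wordProd ω = cs.wordProd (ω'.concat i) := by
    rw [wordProd_concat, ← hw]; simp
  have h0 : cs.simple i ∉ cs.rightInvSeq ω' := by
    intro hmem
    have := (cs.isRightInversion_of_mem_rightInvSeq hr hmem).2
    rw [← hw] at this
    simp only [simple_mul_simple_cancel_right] at this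
    exact absurd h (by unfold IsRightDescent; omega)
  have hcount : (cs.rightInvSeq (ω'.concat i)).count (cs.simple i) = 1 := by
    rw [rightInvSeq_concat, List.concat_eq_append, List.count_append, List.count_singleton_self,
      List.count_eq_zero.2]
    rw [List.mem_map]
    rintro ⟨t, ht, hti⟩
    apply h0
    have : t = cs.simple i := by
      rw [MulAut.conj_apply, mul_inv_eq_iff_eq_mul] at hti
      exact mul_left_cancel hti
    rwa [← this]
  have h1 := cs.signStep_prod ω (cs.simple i, 0)
  rw [hω, cs.signStep_prod] at h1
  have h2 := congrArg Prod.snd h1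
  simp only [hcount, zero_add] at h2
  by_contra hn
  rw [List.count_eq_zero.2 hn] at h2
  simp at h2

/-- The form of the exchange property needed for associativity of the Hecke algebra. -/
theorem simple_mul_eq_mul_simple {w : W} {i j : B} (hi : ¬cs.IsLeftDescent w i)
    (hj : ¬cs.IsRightDescent w j) (h : cs.IsRightDescent (cs.simple i * w) j) :
    cs.simple i * w = w * cs.simple j := by
  obtain ⟨ω, hr, rfl⟩ := cs.exists_isReduced w
  rw [← wordProd_cons] at h
  have := cs.mem_rightInvSeq_of_isRightDescent h
  rw [rightInvSeq, List.mem_cons] at this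
  rcases this with h1 | h1
  · rw [h1]; simp [mul_assoc]
  · exact absurd (cs.isRightInversion_of_mem_rightInvSeq hr h1).2 hj

end CoxeterSystem

namespace CoxeterSystem

variable {B W : Type*} [Group W] {M : CoxeterMatrix B} (cs : CoxeterSystem M W)
variable {K : Type*} [CommRing K] (q : K)

open Classical in
/-- The operator `T_s * ·` on the free module with basis `T_w`: it sends `T_w` to `T_{sw}` if
`sw > w`, and to `q T_{sw} + (q - 1) T_w` if `sw < w`. -/
noncomputable def leftOp (i : B) : (W →₀ K) →ₗ[K] (W →₀ K) :=
  Finsupp.linearCombination K fun w =>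
    if cs.IsLeftDescent w i then
      q • Finsupp.single (cs.simple i * w) 1 + (q - 1) • Finsupp.single w 1
    else Finsupp.single (cs.simple i * w) 1

open Classical in
/-- The operator `· * T_s` on the free module with basis `T_w`. -/
noncomputable def rightOp (i : B) : (W →₀ K) →ₗ[K] (W →₀ K) :=
  Finsupp.linearCombination K fun w =>
    if cs.IsRightDescent w i then
      q • Finsupp.single (w * cs.simple i) 1 + (q - 1) • Finsupp.single w 1
    else Finsupp.single (w * cs.simple i) 1

theorem leftOp_of_up {w : W} {i : B} (h : ¬cs.IsLeftDescent w i) :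
    cs.leftOp q i (Finsupp.single w 1) = Finsupp.single (cs.simple i * w) 1 := by
  simp [leftOp, h]

theorem leftOp_of_down {w : W} {i : B} (h : cs.IsLeftDescent w i) :
    cs.leftOp q i (Finsupp.single w 1) =
      q • Finsupp.single (cs.simple i * w) 1 + (q - 1) • Finsupp.single w 1 := by
  simp [leftOp, h]

theorem rightOp_of_up {w : W} {i : B} (h : ¬cs.IsRightDescent w i) :
    cs.rightOp q i (Finsupp.single w 1) = Finsupp.single (w * cs.simple i) 1 := by
  simp [rightOp, h]

theorem rightOp_of_down {w : W} {i : B} (h : cs.IsRightDescent w i) :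
    cs.rightOp q i (Finsupp.single w 1) =
      q • Finsupp.single (w * cs.simple i) 1 + (q - 1) • Finsupp.single w 1 := by
  simp [rightOp, h]

theorem commute_leftOp_rightOp (i j : B) : Commute (cs.leftOp q i) (cs.rightOp q j) := by
  refine Finsupp.lhom_ext' fun w => LinearMap.ext_ring ?_
  change cs.leftOp q i (cs.rightOp q j (Finsupp.single w 1)) =
    cs.rightOp q j (cs.leftOp q i (Finsupp.single w 1))
  have hl := cs.length_simple_mul w i
  have hr := cs.length_mul_simple w j
  have hlr := cs.length_mul_simple (cs.simple i * w) j
  have hrl := cs.length_simple_mul (w * cs.simple j) i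
  have special : cs.simple i * w = w * cs.simple j → cs.leftOp q i (cs.rightOp q j
      (Finsupp.single w 1)) = cs.rightOp q j (cs.leftOp q i (Finsupp.single w 1)) := by
    intro e
    have e1 : cs.simple i * (w * cs.simple j) = w := by rw [← e]; simp
    have e2 : cs.IsLeftDescent w i ↔ cs.IsRightDescent w j := by
      simp only [IsLeftDescent, IsRightDescent, e]
    have e3 : cs.IsLeftDescent (w * cs.simple j) i ↔ cs.IsRightDescent (w * cs.simple j) j := by
      simp only [IsLeftDescent, IsRightDescent, e1, simple_mul_simple_cancel_right]
    have e4 : cs.IsRightDescent (w * cs.simple j) j ↔ ¬cs.IsRightDescent w j := by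
      simp only [IsRightDescent, simple_mul_simple_cancel_right]
      omega
    by_cases h : cs.IsRightDescent w j <;>
      simp only [leftOp_of_up, leftOp_of_down, rightOp_of_up, rightOp_of_down, e1, e2, e3, e4, h, e,
        simple_mul_simple_cancel_right, map_add, map_smul, not_false_eq_true, not_true_eq_false]
  by_cases h1 : cs.IsLeftDescent w i <;> by_cases h2 : cs.IsRightDescent w j <;>
    by_cases h3 : cs.IsRightDescent (cs.simple i * w) j <;>
    by_cases h4 : cs.IsLeftDescent (w * cs.simple j) i
  all_goals
    first
    | (exfalso; simp only [IsLeftDescent, IsRightDescent, mul_assoc] at h1 h2 h3 h4 hlr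
       omega)
    | (simp only [leftOp_of_up, leftOp_of_down, rightOp_of_up, rightOp_of_down, h1, h2, h3, h4,
        mul_assoc, map_add, map_smul, not_false_eq_true]
       done)
    | (simp only [leftOp_of_up, leftOp_of_down, rightOp_of_up, rightOp_of_down, h1, h2, h3, h4,
        mul_assoc, map_add, map_smul, not_false_eq_true]
       module)
    | (apply special
       exact cs.simple_mul_eq_mul_simple h1 h2 h3)
    | (apply special
       have h5 : ¬cs.IsLeftDescent (cs.simple i * w) i := by
         simp only [IsLeftDescent, simple_mul_simple_cancel_left] at h1 ⊢
         omega
       have h6 := cs.simple_mul_eq_mul_simple h5 h3 (by simpa using h2)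
       rw [simple_mul_simple_cancel_left] at h6
       conv_rhs => rw [h6]
       simp)

theorem ext_of_commute_rightOp {f g : (W →₀ K) →ₗ[K] (W →₀ K)}
    (hf : ∀ i, Commute f (cs.rightOp q i)) (hg : ∀ i, Commute g (cs.rightOp q i))
    (h : f (Finsupp.single 1 1) = g (Finsupp.single 1 1)) : f = g := by
  refine Finsupp.lhom_ext' fun w => LinearMap.ext_ring ?_
  change f (Finsupp.single w 1) = g (Finsupp.single w 1)
  induction hn : cs.length w using Nat.strong_induction_on generalizing w with
  | _ n ih =>
    by_cases hw : w = 1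
    · rw [hw, h]
    obtain ⟨i, hi⟩ := cs.exists_rightDescent_of_ne_one hw
    have hi' := cs.isRightDescent_iff_not_isRightDescent_mul.1 hi
    have e := cs.rightOp_of_up q hi'
    rw [simple_mul_simple_cancel_right] at e
    have hlt : cs.length (w * cs.simple i) < n := hn ▸ hi
    rw [← e]
    have h1 := LinearMap.congr_fun (hf i).eq (Finsupp.single (w * cs.simple i) 1)
    have h2 := LinearMap.congr_fun (hg i).eq (Finsupp.single (w * cs.simple i) 1)
    simp only [Module.End.mul_apply] at h1 h2
    rw [h1, h2, ih _ hlt _ rfl]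

/-- The operator `T_w * ·`, through a reduced word of `w`. -/
noncomputable def basisOp (w : W) : Module.End K (W →₀ K) :=
  (((cs.exists_isReduced w).choose).map (cs.leftOp q)).prod

/-- The multiplication `a ↦ (b ↦ a * b)` of the Hecke algebra. -/
noncomputable def mulOp : (W →₀ K) →ₗ[K] Module.End K (W →₀ K) :=
  Finsupp.linearCombination K (cs.basisOp q)

theorem basisOp_single_one (w : W) :
    cs.basisOp q w (Finsupp.single 1 1) = Finsupp.single w 1 := by
  obtain ⟨hr, hw⟩ := (cs.exists_isReduced w).choose_spec
  rw [basisOp]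
  conv_rhs => rw [hw]
  clear hw
  revert hr
  generalize (cs.exists_isReduced w).choose = ω
  induction ω with
  | nil => simp
  | cons i ω ih =>
    intro hr
    have hr' : cs.IsReduced ω := by simpa using hr.drop 1
    rw [List.map_cons, List.prod_cons, Module.End.mul_apply, ih hr', leftOp_of_up, wordProd_cons]
    rw [IsReduced, wordProd_cons] at hr
    rw [IsReduced] at hr'
    simp only [IsLeftDescent, List.length_cons] at hr ⊢
    omega

theorem mulOp_single (w : W) : cs.mulOp q (Finsupp.single w 1) = cs.basisOp q w := by
  simp [mulOp]

theorem mulOp_one_right (a : W →₀ K) : cs.mulOp q a (Finsupp.single 1 1) = a := by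
  induction a using Finsupp.induction_linear with
  | zero => simp
  | add a b ha hb => rw [map_add, LinearMap.add_apply, ha, hb]
  | single w c =>
    rw [← mul_one c, ← smul_eq_mul, ← Finsupp.smul_single, map_smul, mulOp_single,
      LinearMap.smul_apply, basisOp_single_one]

theorem commute_mulOp_rightOp (a : W →₀ K) (i : B) :
    Commute (cs.mulOp q a) (cs.rightOp q i) := by
  induction a using Finsupp.induction_linear with
  | zero => rw [map_zero]; exact Commute.zero_left _
  | add a b ha hb => rw [map_add]; exact ha.add_left hb
  | single w c =>
    rw [← mul_one c, ← smul_eq_mul, ← Finsupp.smul_single, map_smul, mulOp_single]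
    refine Commute.smul_left ?_ c
    refine Commute.list_prod_left _ _ fun f hf => ?_
    obtain ⟨j, -, rfl⟩ := List.mem_map.1 hf
    exact cs.commute_leftOp_rightOp q j i

theorem mulOp_mulOp (a b : W →₀ K) : cs.mulOp q (cs.mulOp q a b) = cs.mulOp q a * cs.mulOp q b := by
  refine cs.ext_of_commute_rightOp q (cs.commute_mulOp_rightOp q _)
    (fun i => (cs.commute_mulOp_rightOp q _ i).mul_left (cs.commute_mulOp_rightOp q _ i)) ?_
  rw [mulOp_one_right, Module.End.mul_apply, mulOp_one_right]

theorem mulOp_simple (i : B) : cs.mulOp q (Finsupp.single (cs.simple i) 1) = cs.leftOp q i := by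
  refine cs.ext_of_commute_rightOp q (cs.commute_mulOp_rightOp q _)
    (cs.commute_leftOp_rightOp q i) ?_
  rw [mulOp_one_right, leftOp_of_up _ _ (cs.not_isLeftDescent_one i), mul_one]

theorem mulOp_one : cs.mulOp q (Finsupp.single 1 1) = 1 := by
  refine cs.ext_of_commute_rightOp q (cs.commute_mulOp_rightOp q _)
    (fun _ => Commute.one_left _) ?_
  rw [mulOp_one_right, Module.End.one_apply]

end CoxeterSystem

open scoped LaurentPolynomial

/-- The Iwahori-Hecke algebra of a Coxeter system over a commutative ring `K` with a unit `t`
(for example `K = ℚ(t)`): the free `K`-module with basis `T_w`, `w ∈ W`, with the multiplication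
determined by `T_s T_w = T_{sw}` if `sw > w` and `T_s T_w = t² T_{sw} + (t² - 1) T_w` if `sw < w`
(see `T_simple_mul_up` and `T_simple_mul_down`). -/
def HeckeAlgebra {B W : Type*} [Group W] {M : CoxeterMatrix B} (_cs : CoxeterSystem M W)
    {K : Type*} [CommRing K] (_t : Kˣ) : Type _ :=
  W →₀ K

namespace HeckeAlgebra

variable {B W : Type*} [Group W] {M : CoxeterMatrix B} {cs : CoxeterSystem M W}
  {K : Type*} [CommRing K] {t : Kˣ}

noncomputable instance : AddCommGroup (HeckeAlgebra cs t) :=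
  inferInstanceAs (AddCommGroup (W →₀ K))

noncomputable instance : Module K (HeckeAlgebra cs t) :=
  inferInstanceAs (Module K (W →₀ K))

variable (cs t) in
/-- The standard basis element `T_w`. -/
noncomputable def T (w : W) : HeckeAlgebra cs t :=
  (Finsupp.single w 1 : W →₀ K)

/-- The coefficient of `T_y`. -/
noncomputable def coeff (y : W) : HeckeAlgebra cs t →ₗ[K] K :=
  (Finsupp.lapply y : (W →₀ K) →ₗ[K] K)

/-- The product, with quadratic parameter `q = t ^ 2`. -/
noncomputable instance : Mul (HeckeAlgebra cs t) :=
  ⟨fun a b => cs.mulOp ((t : K) ^ 2) a b⟩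

noncomputable instance : One (HeckeAlgebra cs t) := ⟨T cs t 1⟩

theorem mul_def (a b : HeckeAlgebra cs t) : a * b = cs.mulOp ((t : K) ^ 2) a b := rfl

noncomputable instance : Ring (HeckeAlgebra cs t) where
  __ := (inferInstance : AddCommGroup (HeckeAlgebra cs t))
  left_distrib a b c := map_add (cs.mulOp ((t : K) ^ 2) a) b c
  right_distrib a b c := by
    change cs.mulOp ((t : K) ^ 2) (a + b) c = _
    erw [map_add]
    rfl
  zero_mul a := by
    change cs.mulOp ((t : K) ^ 2) 0 a = 0
    rw [map_zero]; rfl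
  mul_zero a := map_zero (cs.mulOp ((t : K) ^ 2) a)
  mul_assoc a b c := LinearMap.congr_fun (cs.mulOp_mulOp ((t : K) ^ 2) a b) c
  one_mul a := LinearMap.congr_fun (cs.mulOp_one ((t : K) ^ 2)) a
  mul_one a := cs.mulOp_one_right ((t : K) ^ 2) a

noncomputable instance : Algebra K (HeckeAlgebra cs t) :=
  Algebra.ofModule
    (fun r a b => by
      change cs.mulOp ((t : K) ^ 2) (r • a) b = _
      erw [map_smul]
      rfl)
    (fun r a b => map_smul (cs.mulOp ((t : K) ^ 2) a) r b)

theorem T_one : T cs t 1 = 1 := rfl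

theorem T_simple_mul_up {w : W} {i : B} (h : ¬cs.IsLeftDescent w i) :
    T cs t (cs.simple i) * T cs t w = T cs t (cs.simple i * w) := by
  rw [mul_def, T, cs.mulOp_simple]
  exact cs.leftOp_of_up _ h

theorem T_simple_mul_down {w : W} {i : B} (h : cs.IsLeftDescent w i) :
    T cs t (cs.simple i) * T cs t w =
      (t : K) ^ 2 • T cs t (cs.simple i * w) + ((t : K) ^ 2 - 1) • T cs t w := by
  rw [mul_def, T, cs.mulOp_simple]
  exact cs.leftOp_of_down _ h

theorem T_mul_simple_up {w : W} {i : B} (h : ¬cs.IsRightDescent w i) :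
    T cs t w * T cs t (cs.simple i) = T cs t (w * cs.simple i) := by
  have h1 := LinearMap.congr_fun (cs.commute_mulOp_rightOp ((t : K) ^ 2) (T cs t w) i).eq
    (Finsupp.single 1 1)
  simp only [Module.End.mul_apply] at h1
  erw [cs.rightOp_of_up _ (cs.not_isRightDescent_one i), cs.mulOp_one_right,
    cs.rightOp_of_up _ h, one_mul] at h1
  exact h1

theorem T_simple_mul_self (i : B) : T cs t (cs.simple i) * T cs t (cs.simple i) =
    (t : K) ^ 2 • 1 + ((t : K) ^ 2 - 1) • T cs t (cs.simple i) := by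
  rw [T_simple_mul_down, cs.simple_mul_simple_self, T_one]
  simp [CoxeterSystem.IsLeftDescent]


variable (cs t) in
theorem isUnit_T_simple (i : B) : IsUnit (T cs t (cs.simple i)) := by
  have h := T_simple_mul_self (cs := cs) (t := t) i
  set x := T cs t (cs.simple i)
  have hx : x * x - ((t : K) ^ 2 - 1) • x = (t : K) ^ 2 • 1 := by rw [h]; abel
  have ht : ((↑t⁻¹ : K) ^ 2) * (t : K) ^ 2 = 1 := by
    rw [← mul_pow, Units.inv_mul, one_pow]
  refine isUnit_iff_exists.2 ⟨(↑t⁻¹ : K) ^ 2 • (x - ((t : K) ^ 2 - 1) • 1), ?_, ?_⟩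
  · rw [mul_smul_comm, mul_sub, mul_smul_comm, mul_one, hx, smul_smul, ht, one_smul]
  · rw [smul_mul_assoc, sub_mul, smul_mul_assoc, one_mul, hx, smul_smul, ht, one_smul]

variable (cs t) in
theorem isUnit_T (w : W) : IsUnit (T cs t w) := by
  induction hn : cs.length w using Nat.strong_induction_on generalizing w with
  | _ n ih =>
    by_cases hw : w = 1
    · rw [hw, T_one]; exact isUnit_one
    obtain ⟨i, hi⟩ := cs.exists_leftDescent_of_ne_one hw
    have e := T_simple_mul_up (t := t) (cs.isLeftDescent_iff_not_isLeftDescent_mul.1 hi)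
    rw [cs.simple_mul_simple_cancel_left] at e
    rw [← e]
    exact (isUnit_T_simple cs t i).mul (ih _ (hn ▸ hi) _ rfl)

theorem inverse_T_simple (i : B) : Ring.inverse (T cs t (cs.simple i)) =
    (↑t⁻¹ : K) ^ 2 • (T cs t (cs.simple i) - ((t : K) ^ 2 - 1) • 1) := by
  have h := T_simple_mul_self (cs := cs) (t := t) i
  have hu := isUnit_T_simple cs t i
  have ht : ((↑t⁻¹ : K) ^ 2) * (t : K) ^ 2 = 1 := by
    rw [← mul_pow, Units.inv_mul, one_pow]
  refine hu.mul_left_cancel ?_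
  rw [Ring.mul_inverse_cancel _ hu, mul_smul_comm, mul_sub, h, mul_smul_comm, mul_one,
    add_sub_cancel_right, smul_smul, ht, one_smul]

theorem coeff_T (y w : W) [Decidable (w = y)] :
    coeff y (T cs t w) = if w = y then 1 else 0 := by
  classical
  change (Finsupp.single w (1 : K)) y = _
  rw [Finsupp.single_apply]

@[ext]
theorem ext_coeff {a b : HeckeAlgebra cs t} (h : ∀ y, coeff y a = coeff y b) : a = b :=
  Finsupp.ext h

theorem induction_on {p : HeckeAlgebra cs t → Prop} (a : HeckeAlgebra cs t) (zero : p 0)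
    (add : ∀ a b, p a → p b → p (a + b)) (smul : ∀ (c : K) (w : W), p (c • T cs t w)) : p a := by
  refine Finsupp.induction_linear (motive := p) a zero add fun w c => ?_
  have := smul c w
  rw [T] at this
  erw [Finsupp.smul_single, smul_eq_mul, mul_one] at this
  exact this

theorem coeff_T_simple_mul_down {y : W} {i : B} (h : cs.IsLeftDescent y i)
    (a : HeckeAlgebra cs t) : coeff y (T cs t (cs.simple i) * a) =
      coeff (cs.simple i * y) a + ((t : K) ^ 2 - 1) * coeff y a := by
  classical
  induction a using induction_on with
  | zero => simp
  | add a b ha hb => rw [mul_add, map_add, ha, hb, map_add, map_add]; ring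
  | smul c w =>
    simp only [mul_smul_comm, map_smul, smul_eq_mul]
    have e1 : (cs.simple i * w = y) ↔ w = cs.simple i * y := by
      constructor <;> rintro rfl <;> simp
    by_cases hw : cs.IsLeftDescent w i
    · have hne : w ≠ cs.simple i * y := by
        rintro rfl
        exact (cs.isLeftDescent_iff_not_isLeftDescent_mul.1 h) hw
      simp only [T_simple_mul_down hw, map_add, map_smul, coeff_T, e1, hne, if_false, smul_eq_mul]
      ring
    · have hne : w ≠ y := by rintro rfl; exact hw h
      simp only [T_simple_mul_up hw, coeff_T, e1, hne, if_false]
      ring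

theorem coeff_T_simple_mul_up {y : W} {i : B} (h : ¬cs.IsLeftDescent y i)
    (a : HeckeAlgebra cs t) : coeff y (T cs t (cs.simple i) * a) =
      (t : K) ^ 2 * coeff (cs.simple i * y) a := by
  classical
  induction a using induction_on with
  | zero => simp
  | add a b ha hb => rw [mul_add, map_add, ha, hb, map_add]; ring
  | smul c w =>
    simp only [mul_smul_comm, map_smul, smul_eq_mul]
    have e1 : (cs.simple i * w = y) ↔ w = cs.simple i * y := by
      constructor <;> rintro rfl <;> simp
    by_cases hw : cs.IsLeftDescent w i
    · have hne : w ≠ y := by rintro rfl; exact h hw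
      simp only [T_simple_mul_down hw, map_add, map_smul, coeff_T, e1, hne, if_false, smul_eq_mul]
      ring
    · have hne : w ≠ cs.simple i * y := by
        rintro rfl
        rw [cs.isLeftDescent_iff_not_isLeftDescent_mul] at hw
        simp at hw
        exact h hw
      simp only [T_simple_mul_up hw, coeff_T, e1, hne, if_false]
      ring

/-- The indeterminate `t` of `ℤ[t, t⁻¹]`, as a unit. -/
noncomputable def tGen : ℤ[T;T⁻¹]ˣ where
  val := LaurentPolynomial.T 1
  inv := LaurentPolynomial.T (-1)
  val_inv := by rw [← LaurentPolynomial.T_add]; rfl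
  inv_val := by rw [← LaurentPolynomial.T_add]; rfl

variable (cs) in
/-- The bar involution of the Hecke algebra over `ℤ[t, t⁻¹]`, which sends `t` to `t⁻¹` and `T_w` to
`(T_{w⁻¹})⁻¹`. -/
noncomputable def bar : HeckeAlgebra cs tGen →+ HeckeAlgebra cs tGen :=
  (Finsupp.liftAddHom fun w : W =>
    ((smulAddHom ℤ[T;T⁻¹] (HeckeAlgebra cs tGen)).flip (Ring.inverse (T cs tGen w⁻¹))).comp
      (LaurentPolynomial.invert (R := ℤ) : ℤ[T;T⁻¹] →+ ℤ[T;T⁻¹]) :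
    (W →₀ ℤ[T;T⁻¹]) →+ HeckeAlgebra cs tGen)

theorem bar_smul_T (c : ℤ[T;T⁻¹]) (w : W) :
    bar cs (c • T cs tGen w) = LaurentPolynomial.invert c • Ring.inverse (T cs tGen w⁻¹) := by
  have : c • T cs tGen w = (Finsupp.single w c : W →₀ ℤ[T;T⁻¹]) := by
    rw [T]; erw [Finsupp.smul_single, smul_eq_mul, mul_one]
  rw [this, bar]
  erw [Finsupp.liftAddHom_apply_single]
  rfl

theorem bar_smul (c : ℤ[T;T⁻¹]) (a : HeckeAlgebra cs tGen) :
    bar cs (c • a) = LaurentPolynomial.invert c • bar cs a := by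
  induction a using induction_on with
  | zero => simp
  | add a b ha hb => simp only [smul_add, map_add, ha, hb]
  | smul d w => rw [smul_smul, bar_smul_T, bar_smul_T, map_mul, mul_smul]

theorem bar_T (w : W) : bar cs (T cs tGen w) = Ring.inverse (T cs tGen w⁻¹) := by
  rw [← one_smul ℤ[T;T⁻¹] (T cs tGen w), bar_smul_T, map_one, one_smul]

theorem bar_T_simple_mul_up {w : W} {i : B} (h : ¬cs.IsLeftDescent w i) :
    bar cs (T cs tGen (cs.simple i * w)) =
      Ring.inverse (T cs tGen (cs.simple i)) * bar cs (T cs tGen w) := by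
  rw [bar_T, bar_T, mul_inv_rev, cs.inv_simple, ← T_mul_simple_up
    (by rwa [cs.isRightDescent_inv_iff])]
  obtain ⟨u, hu⟩ := isUnit_T cs tGen w⁻¹
  obtain ⟨v, hv⟩ := isUnit_T_simple cs tGen i
  rw [← hu, ← hv, ← Units.val_mul, Ring.inverse_unit, Ring.inverse_unit, Ring.inverse_unit,
    mul_inv_rev, Units.val_mul]

theorem bar_T_simple_mul (i : B) (a : HeckeAlgebra cs tGen) :
    bar cs (T cs tGen (cs.simple i) * a) =
      Ring.inverse (T cs tGen (cs.simple i)) * bar cs a := by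
  induction a using induction_on with
  | zero => simp
  | add a b ha hb => simp only [mul_add, map_add, ha, hb]
  | smul c w =>
    rw [mul_smul_comm, bar_smul, bar_smul, mul_smul_comm]
    congr 1
    by_cases hw : cs.IsLeftDescent w i
    · have e := bar_T_simple_mul_up (cs.isLeftDescent_iff_not_isLeftDescent_mul.1 hw)
      rw [cs.simple_mul_simple_cancel_left] at e
      have h2 : LaurentPolynomial.invert ((tGen : ℤ[T;T⁻¹]) ^ 2) = (↑tGen⁻¹ : ℤ[T;T⁻¹]) ^ 2 := by
        rw [map_pow]
        change (LaurentPolynomial.invert (LaurentPolynomial.T 1)) ^ 2 = _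
        rw [LaurentPolynomial.invert_T]
        rfl
      have ht : ((↑tGen⁻¹ : ℤ[T;T⁻¹]) ^ 2) * (tGen : ℤ[T;T⁻¹]) ^ 2 = 1 := by
        rw [← mul_pow, Units.inv_mul, one_pow]
      have hU := inverse_T_simple (cs := cs) (t := tGen) i
      have hxU := Ring.mul_inverse_cancel _ (isUnit_T_simple cs tGen i)
      rw [T_simple_mul_down hw, map_add, bar_smul, bar_smul, map_sub, map_one, h2, e, ← mul_assoc]
      generalize Ring.inverse (T cs tGen (cs.simple i)) = U at hU hxU
      generalize T cs tGen (cs.simple i) = x at hU hxU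
      have key : U * U = (↑tGen⁻¹ : ℤ[T;T⁻¹]) ^ 2 • 1 + ((↑tGen⁻¹ : ℤ[T;T⁻¹]) ^ 2 - 1) • U := by
        nth_rw 1 [hU]
        rw [smul_mul_assoc, sub_mul, hxU, smul_mul_assoc, one_mul, smul_sub, smul_smul, mul_sub,
          ht, mul_one]
        module
      rw [key, add_mul, smul_mul_assoc, one_mul, smul_mul_assoc]
    · rw [T_simple_mul_up hw, bar_T_simple_mul_up hw]

/-- The element `t⁻¹ (T_s + 1)`. -/
noncomputable def klSimple (i : B) : HeckeAlgebra cs tGen :=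
  (↑tGen⁻¹ : ℤ[T;T⁻¹]) • (T cs tGen (cs.simple i) + 1)

theorem bar_klSimple_mul (i : B) (a : HeckeAlgebra cs tGen) :
    bar cs (klSimple i * a) = klSimple i * bar cs a := by
  have hU := inverse_T_simple (cs := cs) (t := tGen) i
  have h1 : LaurentPolynomial.invert (↑tGen⁻¹ : ℤ[T;T⁻¹]) = tGen := by
    change (LaurentPolynomial.invert (LaurentPolynomial.T (-1))) = _
    rw [LaurentPolynomial.invert_T]
    rfl
  have ht : (↑tGen⁻¹ : ℤ[T;T⁻¹]) * tGen = 1 := Units.inv_mul _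
  rw [klSimple, smul_mul_assoc, bar_smul, add_mul, map_add, bar_T_simple_mul, hU, h1, one_mul,
    smul_mul_assoc, smul_mul_assoc, sub_mul, add_mul, smul_mul_assoc, one_mul]
  match_scalars
  · linear_combination (↑tGen⁻¹ : ℤ[T;T⁻¹]) * ht
  · linear_combination (-(tGen : ℤ[T;T⁻¹]) - (↑tGen⁻¹ : ℤ[T;T⁻¹]) * (tGen : ℤ[T;T⁻¹]) ^ 2 +
      (↑tGen⁻¹ : ℤ[T;T⁻¹])) * ht

/-- The coefficient of `a` at the normalized basis element `t^{-ℓ(y)} T_y`. -/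
noncomputable def normCoeff (y : W) (a : HeckeAlgebra cs tGen) : ℤ[T;T⁻¹] :=
  LaurentPolynomial.T (cs.length y) * coeff y a

theorem tGen_val : (tGen : ℤ[T;T⁻¹]) = LaurentPolynomial.T 1 := rfl
theorem tGen_inv_val : (↑tGen⁻¹ : ℤ[T;T⁻¹]) = LaurentPolynomial.T (-1) := rfl

theorem coeff_T_mul (n m : ℤ) (f : ℤ[T;T⁻¹]) :
    (LaurentPolynomial.T n * f).coeff m = f.coeff (m - n) := by
  have := AddMonoidAlgebra.coeff_single_mul_apply f (1 : ℤ) n m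
  rw [one_mul] at this
  rw [LaurentPolynomial.T]
  convert this using 2
  ring

theorem normCoeff_klSimple_mul_down {y : W} {i : B} (h : cs.IsLeftDescent y i)
    (a : HeckeAlgebra cs tGen) : normCoeff y (klSimple i * a) =
      normCoeff (cs.simple i * y) a + LaurentPolynomial.T 1 * normCoeff y a := by
  have hl := cs.isLeftDescent_iff.1 h
  rw [klSimple, normCoeff, normCoeff, normCoeff, smul_mul_assoc, add_mul, one_mul, map_smul,
    map_add, coeff_T_simple_mul_down h, ← hl, smul_eq_mul, tGen_val, tGen_inv_val]
  push_cast
  rw [LaurentPolynomial.T_add]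
  have ht : LaurentPolynomial.T (-1) * LaurentPolynomial.T 1 = (1 : ℤ[T;T⁻¹]) := by
    rw [← LaurentPolynomial.T_add]; rfl
  generalize (LaurentPolynomial.T (-1) : ℤ[T;T⁻¹]) = u at *
  generalize (LaurentPolynomial.T 1 : ℤ[T;T⁻¹]) = v at *
  generalize (LaurentPolynomial.T (cs.length (cs.simple i * y)) : ℤ[T;T⁻¹]) = x at *
  linear_combination (x * (coeff (cs.simple i * y)) a + x * v ^ 2 * coeff y a) * ht

theorem normCoeff_klSimple_mul_up {y : W} {i : B} (h : ¬cs.IsLeftDescent y i)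
    (a : HeckeAlgebra cs tGen) : normCoeff y (klSimple i * a) =
      normCoeff (cs.simple i * y) a + LaurentPolynomial.T (-1) * normCoeff y a := by
  have hl := cs.not_isLeftDescent_iff.1 h
  rw [klSimple, normCoeff, normCoeff, normCoeff, smul_mul_assoc, add_mul, one_mul, map_smul,
    map_add, coeff_T_simple_mul_up h, hl, smul_eq_mul, tGen_val, tGen_inv_val]
  push_cast
  rw [LaurentPolynomial.T_add]
  have ht : LaurentPolynomial.T (-1) * LaurentPolynomial.T 1 = (1 : ℤ[T;T⁻¹]) := by
    rw [← LaurentPolynomial.T_add]; rfl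
  generalize (LaurentPolynomial.T (-1) : ℤ[T;T⁻¹]) = u at *
  generalize (LaurentPolynomial.T 1 : ℤ[T;T⁻¹]) = v at *
  generalize (LaurentPolynomial.T (cs.length y) : ℤ[T;T⁻¹]) = x at *
  linear_combination (x * v * (coeff (cs.simple i * y)) a) * ht

/-- The defining property of the Kazhdan-Lusztig element `C'_w`: it is fixed by the bar involution,
and `C'_w = ∑ y, p y • (t^{-ℓ(y)} T_y)` with `p w = 1` and `p y ∈ t⁻¹ ℤ[t⁻¹]` for `y ≠ w`
(here `p y = t^{ℓ(y) - ℓ(w)} P_{y,w}(t²)` for the Kazhdan-Lusztig polynomial `P_{y,w}`). -/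
structure IsKazhdanLusztig (w : W) (c : HeckeAlgebra cs tGen) : Prop where
  bar_eq : bar cs c = c
  normCoeff_self : normCoeff w c = 1
  normCoeff_of_ne : ∀ y, y ≠ w → ∀ n : ℤ, 0 ≤ n → (normCoeff y c).coeff n = 0

theorem normCoeff_eq_zero {y : W} {a : HeckeAlgebra cs tGen} :
    normCoeff y a = 0 ↔ coeff y a = 0 := by
  constructor
  · intro h
    have := congrArg (LaurentPolynomial.T (-(cs.length y : ℤ)) * ·) h
    simpa [normCoeff, ← mul_assoc, ← LaurentPolynomial.T_add] using this
  · intro h; rw [normCoeff, h, mul_zero]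

theorem normCoeff_add (y : W) (a b : HeckeAlgebra cs tGen) :
    normCoeff y (a + b) = normCoeff y a + normCoeff y b := by
  simp [normCoeff, mul_add]

theorem normCoeff_smul (y : W) (r : ℤ[T;T⁻¹]) (a : HeckeAlgebra cs tGen) :
    normCoeff y (r • a) = r * normCoeff y a := by
  simp only [normCoeff, map_smul, smul_eq_mul]; ring

theorem normCoeff_sum {ι : Type*} (s : Finset ι) (y : W) (f : ι → HeckeAlgebra cs tGen) :
    normCoeff y (∑ z ∈ s, f z) = ∑ z ∈ s, normCoeff y (f z) := by
  simp [normCoeff, Finset.mul_sum]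

theorem exists_support (a : HeckeAlgebra cs tGen) : ∃ S : Finset W, ∀ y, y ∈ S ↔ coeff y a ≠ 0 :=
  ⟨Finsupp.support (M := ℤ[T;T⁻¹]) a, fun _ => Finsupp.mem_support_iff⟩

theorem one_coeff_zero : (1 : ℤ[T;T⁻¹]).coeff 0 = 1 := by
  rw [← LaurentPolynomial.T_zero, LaurentPolynomial.T, AddMonoidAlgebra.coeff_single,
    Finsupp.single_eq_same]

theorem exists_isKazhdanLusztig_aux (w : W) : ∃ c : HeckeAlgebra cs tGen, IsKazhdanLusztig w c ∧
    ∀ y, y ≠ w → cs.length w ≤ cs.length y → coeff y c = 0 := by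
  classical
  induction hn : cs.length w using Nat.strong_induction_on generalizing w with
  | _ n ih =>
    by_cases hw : w = 1
    · subst hw
      have hc : ∀ y, y ≠ 1 → coeff y (T cs tGen 1) = 0 := fun y hy => by
        rw [coeff_T, if_neg (Ne.symm hy)]
      refine ⟨T cs tGen 1, ⟨?_, ?_, ?_⟩, fun y hy _ => hc y hy⟩
      · rw [bar_T, inv_one, T_one, Ring.inverse_one]
      · rw [normCoeff, coeff_T, if_pos rfl, cs.length_one]; simp
      · intro y hy n _
        rw [normCoeff, hc y hy]; simp
    obtain ⟨i, hi⟩ := cs.exists_leftDescent_of_ne_one hw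
    have hl := cs.isLeftDescent_iff.1 hi
    obtain ⟨c, hc, hcs⟩ := ih _ (hn ▸ hi) (cs.simple i * w) rfl
    set v := cs.simple i * w with hv
    have hw' : w = cs.simple i * v := by simp [hv]
    set d := klSimple i * c with hd
    have hdbar : bar cs d = d := by rw [hd, bar_klSimple_mul, hc.bar_eq]
    have hdw : normCoeff w d = 1 := by
      rw [hd, normCoeff_klSimple_mul_down hi, hc.normCoeff_self, normCoeff_eq_zero.2, mul_zero,
        add_zero]
      refine hcs w ?_ (by omega)
      intro h; rw [← h] at hl; omega
    have hdsupp : ∀ y, y ≠ w → n ≤ cs.length y → coeff y d = 0 := by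
      intro y hy hny
      rw [← normCoeff_eq_zero]
      have hyv : cs.simple i * y ≠ v := by
        intro h; exact hy (mul_left_cancel h)
      have h1 : normCoeff (cs.simple i * y) c = 0 := by
        rw [normCoeff_eq_zero]
        refine hcs _ hyv ?_
        have := cs.length_simple_mul y i
        omega
      have h2 : normCoeff y c = 0 := by
        rw [normCoeff_eq_zero]
        refine hcs _ ?_ (by omega)
        intro h; rw [h] at hny; omega
      by_cases hyd : cs.IsLeftDescent y i
      · rw [hd, normCoeff_klSimple_mul_down hyd, h1, h2]; simp
      · rw [hd, normCoeff_klSimple_mul_up hyd, h1, h2]; simp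
    have hpos : ∀ y, y ≠ w → ∀ m : ℤ, 0 < m → (normCoeff y d).coeff m = 0 := by
      intro y hy m hm
      have hyv : cs.simple i * y ≠ v := by
        intro h; exact hy (mul_left_cancel h)
      have h1 := hc.normCoeff_of_ne _ hyv m hm.le
      by_cases hyd : cs.IsLeftDescent y i
      · have hne : y ≠ v := by
          rintro rfl
          exact (cs.isLeftDescent_iff_not_isLeftDescent_mul.1 hi) hyd
        rw [hd, normCoeff_klSimple_mul_down hyd, AddMonoidAlgebra.coeff_add, Finsupp.add_apply, h1, coeff_T_mul,
          hc.normCoeff_of_ne _ hne _ (by omega), add_zero]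
      · rw [hd, normCoeff_klSimple_mul_up hyd, AddMonoidAlgebra.coeff_add, Finsupp.add_apply, h1, coeff_T_mul, zero_add]
        by_cases hne : y = v
        · rw [hne, hc.normCoeff_self, ← LaurentPolynomial.T_zero, LaurentPolynomial.T]
          rw [AddMonoidAlgebra.coeff_single, Finsupp.single_apply, if_neg (by omega)]
        · exact hc.normCoeff_of_ne _ hne _ (by omega)
    -- subtract the constant terms
    have ih' : ∀ z, ∃ e : HeckeAlgebra cs tGen, cs.length z < n → (IsKazhdanLusztig z e ∧
        ∀ y, y ≠ z → cs.length z ≤ cs.length y → coeff y e = 0) := by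
      intro z
      by_cases hz : cs.length z < n
      · obtain ⟨e, he⟩ := ih _ hz z rfl
        exact ⟨e, fun _ => he⟩
      · exact ⟨0, fun h => absurd h hz⟩
    choose e he using ih'
    obtain ⟨S₀, hS₀⟩ := exists_support d
    let S : Finset W := S₀.erase w
    have hS : ∀ z, z ∈ S → cs.length z < n := by
      intro z hz
      rw [Finset.mem_erase, hS₀] at hz
      by_contra hzn
      exact hz.2 (hdsupp z hz.1 (by omega))
    let m : W → ℤ := fun z => (normCoeff z d).coeff 0
    have hcoef : ∀ y, normCoeff y (d + ∑ z ∈ S, LaurentPolynomial.C (-m z) • e z) =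
        normCoeff y d + ∑ z ∈ S, LaurentPolynomial.C (-m z) * normCoeff y (e z) := by
      intro y
      rw [normCoeff_add, normCoeff_sum]
      simp only [normCoeff_smul]
    have hlong : ∀ y, n ≤ cs.length y → ∀ z ∈ S, normCoeff y (e z) = 0 := by
      intro y hy z hz
      have hzn := hS z hz
      rw [normCoeff_eq_zero]
      exact (he z hzn).2 y (by rintro rfl; omega) (by omega)
    refine ⟨d + ∑ z ∈ S, LaurentPolynomial.C (-m z) • e z, ⟨?_, ?_, ?_⟩, ?_⟩
    · rw [map_add, hdbar, map_sum]
      congr 1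
      refine Finset.sum_congr rfl fun z hz => ?_
      rw [bar_smul, LaurentPolynomial.invert_C, (he z (hS z hz)).1.bar_eq]
    · rw [hcoef, hdw, Finset.sum_eq_zero, add_zero]
      intro z hz
      rw [hlong w hn.ge z hz, mul_zero]
    · intro y hy k hk
      rw [hcoef, AddMonoidAlgebra.coeff_add, Finsupp.add_apply, AddMonoidAlgebra.coeff_sum,
        Finsupp.finsetSum_apply]
      have hCc : ∀ (r : ℤ) (f : ℤ[T;T⁻¹]), (LaurentPolynomial.C r * f).coeff k = r * f.coeff k := by
        intro r f
        rw [← LaurentPolynomial.smul_eq_C_mul]; rfl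
      simp only [hCc]
      have hz0 : ∀ z ∈ S, z ≠ y → -m z * (normCoeff y (e z)).coeff k = 0 := by
        intro z hz hzy
        rw [(he z (hS z hz)).1.normCoeff_of_ne y (Ne.symm hzy) k hk, mul_zero]
      by_cases hyS : y ∈ S
      · rw [Finset.sum_eq_single_of_mem y hyS hz0, (he y (hS y hyS)).1.normCoeff_self]
        rcases hk.eq_or_lt with rfl | hk
        · rw [one_coeff_zero]; simp [m]
        · rw [hpos y hy k hk, ← LaurentPolynomial.T_zero, LaurentPolynomial.T,
            AddMonoidAlgebra.coeff_single, Finsupp.single_apply, if_neg (by omega)]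
          simp
      · rw [Finset.sum_eq_zero, add_zero]
        · have : coeff y d = 0 := by
            by_contra h
            exact hyS (Finset.mem_erase.2 ⟨hy, (hS₀ y).2 h⟩)
          rw [normCoeff_eq_zero.2 this]; simp
        · intro z hz
          exact hz0 z hz (by rintro rfl; exact hyS hz)
    · intro y hy hny
      rw [← normCoeff_eq_zero, hcoef, normCoeff_eq_zero.2 (hdsupp y hy hny), Finset.sum_eq_zero,
        add_zero]
      intro z hz
      rw [hlong y hny z hz, mul_zero]

theorem coeff_inverse_T_simple_mul (y : W) (i : B) (b : HeckeAlgebra cs tGen)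
    (h1 : coeff (cs.simple i * y) b = 0) (h2 : coeff y b = 0) :
    coeff y (Ring.inverse (T cs tGen (cs.simple i)) * b) = 0 := by
  rw [inverse_T_simple, smul_mul_assoc, sub_mul, smul_mul_assoc, one_mul, map_smul, map_sub,
    map_smul, h2]
  by_cases h : cs.IsLeftDescent y i
  · rw [coeff_T_simple_mul_down h, h1, h2]; simp
  · rw [coeff_T_simple_mul_up h, h1]; simp

theorem coeff_bar_T (w : W) : coeff w (bar cs (T cs tGen w)) =
      LaurentPolynomial.T (-2 * cs.length w) ∧
    ∀ y, y ≠ w → cs.length w ≤ cs.length y → coeff y (bar cs (T cs tGen w)) = 0 := by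
  classical
  induction hn : cs.length w using Nat.strong_induction_on generalizing w with
  | _ n ih =>
    by_cases hw : w = 1
    · subst hw
      rw [bar_T, inv_one, T_one, Ring.inverse_one, ← T_one, ← hn]
      refine ⟨?_, fun y hy _ => ?_⟩
      · rw [coeff_T, if_pos rfl, cs.length_one]; simp
      · rw [coeff_T, if_neg (Ne.symm hy)]
    obtain ⟨i, hi⟩ := cs.exists_leftDescent_of_ne_one hw
    have hl := cs.isLeftDescent_iff.1 hi
    obtain ⟨h1, h2⟩ := ih _ (hn ▸ hi) (cs.simple i * w) rfl
    have e := bar_T_simple_mul_up (cs.isLeftDescent_iff_not_isLeftDescent_mul.1 hi)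
    rw [cs.simple_mul_simple_cancel_left] at e
    rw [e]
    constructor
    · rw [inverse_T_simple, smul_mul_assoc, sub_mul, smul_mul_assoc, one_mul, map_smul, map_sub,
        map_smul, coeff_T_simple_mul_down hi, h1, smul_eq_mul, smul_eq_mul, add_sub_cancel_right,
        tGen_inv_val, LaurentPolynomial.T_pow, ← LaurentPolynomial.T_add]
      congr 1
      push_cast
      omega
    · intro y hy hny
      refine coeff_inverse_T_simple_mul _ _ _ (h2 _ ?_ ?_) (h2 _ ?_ (by omega))
      · intro h; exact hy (mul_left_cancel h)
      · have := cs.length_simple_mul y i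
        omega
      · intro h; rw [h] at hny; omega

theorem eq_zero_of_bar_eq {a : HeckeAlgebra cs tGen} (ha : bar cs a = a)
    (h : ∀ y, ∀ n : ℤ, 0 ≤ n → (normCoeff y a).coeff n = 0) : a = 0 := by
  classical
  obtain ⟨S, hS⟩ := exists_support a
  by_contra hne
  have hSne : S.Nonempty := by
    by_contra hemp
    rw [Finset.not_nonempty_iff_eq_empty] at hemp
    apply hne
    ext1 y
    rw [map_zero]
    by_contra hy
    have := (hS y).2 hy
    simp [hemp] at this
  obtain ⟨y, hy, hmax⟩ := S.exists_max_image cs.length hSne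
  have hsum : a = ∑ z ∈ S, coeff z a • T cs tGen z := by
    ext1 x
    rw [map_sum]
    simp only [map_smul, coeff_T, smul_eq_mul, mul_ite, mul_one, mul_zero, Finset.sum_ite_eq']
    split_ifs with hx
    · rfl
    · by_contra h'
      exact hx ((hS x).2 h')
  have hbar : coeff y a = LaurentPolynomial.invert (coeff y a) *
      LaurentPolynomial.T (-2 * cs.length y) := by
    conv_lhs => rw [← ha, hsum]
    rw [map_sum, map_sum, Finset.sum_eq_single_of_mem y hy]
    · rw [bar_smul, map_smul, (coeff_bar_T y).1, smul_eq_mul]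
    · intro z hz hzy
      rw [bar_smul, map_smul, (coeff_bar_T z).2 y (Ne.symm hzy) (hmax z hz), smul_zero]
  refine (hS y).1 hy (normCoeff_eq_zero.1 ?_)
  have hsymm : ∀ m : ℤ, (normCoeff y a).coeff m = (normCoeff y a).coeff (-m) := by
    intro m
    rw [normCoeff, coeff_T_mul, coeff_T_mul]
    conv_lhs => rw [hbar, mul_comm, coeff_T_mul, LaurentPolynomial.invert_apply]
    congr 1
    ring
  ext m
  rcases le_total 0 m with hm | hm
  · rw [h y m hm]; rfl
  · rw [hsymm, h y _ (by omega)]; rfl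

theorem existsUnique_isKazhdanLusztig (w : W) :
    ∃! c : HeckeAlgebra cs tGen, IsKazhdanLusztig w c := by
  obtain ⟨c, hc, -⟩ := exists_isKazhdanLusztig_aux (cs := cs) w
  refine ⟨c, hc, fun d hd => ?_⟩
  rw [← sub_eq_zero]
  refine eq_zero_of_bar_eq (by rw [map_sub, hd.bar_eq, hc.bar_eq]) fun y n hn => ?_
  have hsub : normCoeff y (d - c) = normCoeff y d - normCoeff y c := by
    simp [normCoeff, mul_sub]
  by_cases hy : y = w
  · rw [hsub, hy, hd.normCoeff_self, hc.normCoeff_self, sub_self]; rfl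
  · rw [hsub, AddMonoidAlgebra.coeff_sub, Finsupp.sub_apply, hd.normCoeff_of_ne y hy n hn,
      hc.normCoeff_of_ne y hy n hn, sub_zero]

variable (cs) in
/-- The Kazhdan-Lusztig basis element `C'_w` of the Hecke algebra over `ℤ[t, t⁻¹]`. -/
noncomputable def klBasis (w : W) : HeckeAlgebra cs tGen :=
  (existsUnique_isKazhdanLusztig w).choose

/-- Extension of scalars `ℤ[t, t⁻¹] → K`, `t ↦ t`, applied to the coefficients at the `T_w`. -/
noncomputable def specialize (t : Kˣ) : HeckeAlgebra cs tGen →+ HeckeAlgebra cs t :=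
  (Finsupp.mapRange.addMonoidHom
    (LaurentPolynomial.eval₂ (Int.castRingHom K) t : ℤ[T;T⁻¹] →+ K) :
    (W →₀ ℤ[T;T⁻¹]) →+ (W →₀ K))

variable (cs t) in
/-- The Kazhdan-Lusztig basis element `C'_w` of the Hecke algebra over `K`. -/
noncomputable def klElement (w : W) : HeckeAlgebra cs t :=
  specialize t (klBasis cs w)

/-- The `K`-linear involution `T_w ↦ T_{w⁻¹}`. -/
noncomputable def involution : HeckeAlgebra cs t →ₗ[K] HeckeAlgebra cs t :=
  (Finsupp.lmapDomain K K (fun w : W => w⁻¹) : (W →₀ K) →ₗ[K] (W →₀ K))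

/-- The coefficient `μ(x, w)` of `q^{(ℓ(w) - ℓ(x) - 1)/2}` in the Kazhdan-Lusztig polynomial
`P_{x,w}`; it is zero unless `x < w`. -/
noncomputable def mu (cs : CoxeterSystem M W) (x w : W) : ℤ :=
  (normCoeff x (klBasis cs w)).coeff (-1)

/-- The relation that generates the left preorder: `x` and `w` are joined in the `W`-graph, and the
left descent set of `x` is not contained in that of `w`. -/
def LeftEdge (cs : CoxeterSystem M W) (x w : W) : Prop :=
  (mu cs x w ≠ 0 ∨ mu cs w x ≠ 0) ∧ ∃ i, cs.IsLeftDescent x i ∧ ¬cs.IsLeftDescent w i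

/-- The Kazhdan-Lusztig left preorder `x ≤_L w`. -/
def LeftLE (cs : CoxeterSystem M W) : W → W → Prop :=
  Relation.ReflTransGen (LeftEdge cs)

/-- A left cell is an equivalence class for the relation `x ≤_L w ∧ w ≤_L x`. -/
def IsLeftCell (cs : CoxeterSystem M W) (C : Set W) : Prop :=
  ∃ w, C = {x | LeftLE cs x w ∧ LeftLE cs w x}

/-- The elements that are `≤_L` some element of `C`. -/
def leftLower (cs : CoxeterSystem M W) (C : Set W) : Set W :=
  {y | ∃ w ∈ C, LeftLE cs y w}

variable (cs t) in
/-- The left ideal generated by the `C'_y`, `y ∈ S`. -/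
noncomputable def leftIdeal (S : Set W) : Submodule (HeckeAlgebra cs t) (HeckeAlgebra cs t) :=
  Submodule.span (HeckeAlgebra cs t) (klElement cs t '' S)

variable (cs t) in
/-- The left cell representation of `C`: the left ideal of the `C'_y` with `y ≤_L C`, modulo the left
ideal of those with `y ≤_L C` and `y ∉ C`. -/
abbrev CellModule (C : Set W) : Type _ :=
  leftIdeal cs t (leftLower cs C) ⧸
    (leftIdeal cs t (leftLower cs C \ C)).submoduleOf (leftIdeal cs t (leftLower cs C))

variable (cs t) in
/-- The basis vector `c_x` of the left cell representation, the class of `C'_x`, for `x ∈ C`. -/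
noncomputable def cellBasis {C : Set W} (x : C) : CellModule cs t C :=
  Submodule.Quotient.mk ⟨klElement cs t x,
    Submodule.subset_span ⟨x, ⟨x, x.2, Relation.ReflTransGen.refl⟩, rfl⟩⟩

/-- Invariance of a bilinear form: `⟨T_w v, v'⟩ = ⟨v, (T_w)^* v'⟩` for all `w`, `v`, `v'`. -/
def IsInvariantForm {V : Type*} [AddCommGroup V] [Module K V] [Module (HeckeAlgebra cs t) V]
    (φ : LinearMap.BilinForm K V) : Prop :=
  ∀ (w : W) (v v' : V), φ (T cs t w • v) v' = φ v (involution (T cs t w) • v')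

end HeckeAlgebra

/-!
The identity is the eigenvector property of the Kazhdan-Lusztig basis read through the form. If `s`
is a left descent of `x`, then `C'_s C'_x = (t + t⁻¹) C'_x` (`klElement_simple_mul`), so `C'_s` acts
on `c_x` as the scalar `t + t⁻¹`. As `C'_s = t⁻¹ (T_s + 1)` (`klElement_simple`) is fixed by the
involution `*`, it is self-adjoint for an invariant form (`IsInvariantForm.klElement_simple_smul`),
and moving it from `c_w` to `c_x` gives the theorem.

The eigenvector property is proved over `ℤ[t, t⁻¹]` (`klSimple_mul_eq_smul`) without the recursion
for the Kazhdan-Lusztig basis. The defect `D = C'_s c - (t + t⁻¹) c` of `c = C'_x` is fixed by the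
bar involution and killed by `C'_s`. The second fact says that the normalized coefficients of `D` at
`y` and `s y` differ by a unit, so that an element `y` of maximal length in the support of `D` has
`s y < y`. By the first fact the coefficient at such a `y` is symmetric under `t ↦ t⁻¹`; but for
`s y < y` it lies in `t⁻¹ ℤ[t⁻¹]`, hence it is zero, and `D = 0`. The result passes to `K` because
specialization commutes with left multiplication by `C'_s`.
-/

namespace HeckeAlgebra

variable {B W : Type*} [Group W] {M : CoxeterMatrix B} {cs : CoxeterSystem M W}
  {K : Type*} [CommRing K] {t : Kˣ}

/-! ### The action of `C'_s` on the Kazhdan-Lusztig basis over `ℤ[t, t⁻¹]` -/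

/-- The bar involution is unitriangular up to powers of `t`, so the top normalized coefficients of a
bar-invariant element are symmetric under `t ↦ t⁻¹`. -/
theorem normCoeff_coeff_neg_of_bar_eq {a : HeckeAlgebra cs tGen} (ha : bar cs a = a) {y : W}
    (hmax : ∀ z, coeff z a ≠ 0 → cs.length z ≤ cs.length y) (m : ℤ) :
    (normCoeff y a).coeff (-m) = (normCoeff y a).coeff m := by
  classical
  obtain ⟨S, hS⟩ := exists_support a
  have hsum : a = ∑ z ∈ S, coeff z a • T cs tGen z := by
    ext1 x
    rw [map_sum]
    simp only [map_smul, coeff_T, smul_eq_mul, mul_ite, mul_one, mul_zero, Finset.sum_ite_eq']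
    split_ifs with hx
    · rfl
    · by_contra h'
      exact hx ((hS x).2 h')
  have hbar : coeff y a = LaurentPolynomial.invert (coeff y a) *
      LaurentPolynomial.T (-2 * cs.length y) := by
    conv_lhs => rw [← ha, hsum]
    rw [map_sum, map_sum, Finset.sum_eq_single y]
    · rw [bar_smul, map_smul, (coeff_bar_T y).1, smul_eq_mul]
    · intro z hz hzy
      rw [bar_smul, map_smul, (coeff_bar_T z).2 y (Ne.symm hzy) (hmax z ((hS z).1 hz)), smul_zero]
    · intro hy
      rw [not_not.1 (mt (hS y).2 hy), zero_smul, map_zero, map_zero]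
  rw [normCoeff, coeff_T_mul, coeff_T_mul]
  conv_rhs => rw [hbar, mul_comm, coeff_T_mul, LaurentPolynomial.invert_apply]
  congr 1
  ring

theorem normCoeff_sub (y : W) (a b : HeckeAlgebra cs tGen) :
    normCoeff y (a - b) = normCoeff y a - normCoeff y b := by
  simp [normCoeff, mul_sub]

theorem T_neg_one_mul_T_one :
    (LaurentPolynomial.T (-1) * LaurentPolynomial.T 1 : ℤ[T;T⁻¹]) = 1 := by
  rw [← LaurentPolynomial.T_add]; rfl

theorem klSimple_mul_self (i : B) : (klSimple i * klSimple i : HeckeAlgebra cs tGen) =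
    (LaurentPolynomial.T 1 + LaurentPolynomial.T (-1) : ℤ[T;T⁻¹]) • klSimple i := by
  have h := T_simple_mul_self (cs := cs) (t := tGen) i
  have ht := T_neg_one_mul_T_one
  rw [klSimple, smul_mul_assoc, mul_smul_comm, add_mul, mul_add, h, mul_one, one_mul, tGen_val,
    tGen_inv_val]
  match_scalars <;>
    linear_combination (LaurentPolynomial.T (-1) * LaurentPolynomial.T 1 : ℤ[T;T⁻¹]) * ht

/-- Elements of the Kazhdan-Lusztig basis with `s` in their left descent set are eigenvectors of
`C'_s`, with eigenvalue `t + t⁻¹`. -/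
theorem klSimple_mul_eq_smul {x : W} {i : B} (hx : cs.IsLeftDescent x i)
    {c : HeckeAlgebra cs tGen} (hc : IsKazhdanLusztig x c) :
    klSimple i * c = (LaurentPolynomial.T 1 + LaurentPolynomial.T (-1) : ℤ[T;T⁻¹]) • c := by
  classical
  set D := klSimple i * c -
    (LaurentPolynomial.T 1 + LaurentPolynomial.T (-1) : ℤ[T;T⁻¹]) • c with hD
  have hbar : bar cs D = D := by
    rw [hD, map_sub, bar_klSimple_mul, bar_smul, hc.bar_eq, map_add, LaurentPolynomial.invert_T,
      LaurentPolynomial.invert_T, neg_neg, add_comm (LaurentPolynomial.T (-1))]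
  have hkill : klSimple i * D = 0 := by
    rw [hD, mul_sub, ← mul_assoc, klSimple_mul_self, mul_smul_comm, smul_mul_assoc, sub_self]
  -- the two terms `t • c` cancel at a `y` with `s y < y`, and `s y = x` is impossible there
  have hneg : ∀ y, cs.IsLeftDescent y i → ∀ m : ℤ, 0 ≤ m → (normCoeff y D).coeff m = 0 := by
    intro y hy m hm
    have hyx : cs.simple i * y ≠ x := by
      rintro rfl
      exact (cs.isLeftDescent_iff_not_isLeftDescent_mul.1 hy) hx
    have e : normCoeff y D = normCoeff (cs.simple i * y) c -
        LaurentPolynomial.T (-1) * normCoeff y c := by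
      rw [hD, normCoeff_sub, normCoeff_klSimple_mul_down hy, normCoeff_smul]
      ring
    rw [e, AddMonoidAlgebra.coeff_sub, Finsupp.sub_apply, hc.normCoeff_of_ne _ hyx m hm,
      coeff_T_mul]
    by_cases h : y = x
    · rw [h, hc.normCoeff_self, ← LaurentPolynomial.T_zero, LaurentPolynomial.T,
        AddMonoidAlgebra.coeff_single, Finsupp.single_apply, if_neg (by omega), sub_zero]
    · rw [hc.normCoeff_of_ne y h _ (by omega), sub_zero]
  rw [← sub_eq_zero, ← hD]
  by_contra hne
  obtain ⟨S, hS⟩ := exists_support D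
  have hSne : S.Nonempty := by
    by_contra hemp
    rw [Finset.not_nonempty_iff_eq_empty] at hemp
    apply hne
    ext1 y
    rw [map_zero]
    by_contra hy
    have := (hS y).2 hy
    simp [hemp] at this
  obtain ⟨y, hy, hmax⟩ := S.exists_max_image cs.length hSne
  have hmax' : ∀ z, coeff z D ≠ 0 → cs.length z ≤ cs.length y := fun z hz => hmax z ((hS z).2 hz)
  -- otherwise `s y` is longer than `y` and has a nonzero coefficient, as `C'_s D = 0`
  have hyd : cs.IsLeftDescent y i := by
    by_contra hyu
    have h0 : normCoeff y (klSimple i * D) = 0 := by rw [hkill, normCoeff_eq_zero, map_zero]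
    have hl := cs.not_isLeftDescent_iff.1 hyu
    have hz : normCoeff (cs.simple i * y) D = 0 := by
      rw [normCoeff_eq_zero]
      by_contra h
      have := hmax' _ h
      omega
    rw [normCoeff_klSimple_mul_up hyu, hz, zero_add] at h0
    refine (hS y).1 hy (normCoeff_eq_zero.1 ?_)
    linear_combination (LaurentPolynomial.T 1 : ℤ[T;T⁻¹]) * h0 -
      normCoeff y D * T_neg_one_mul_T_one
  refine (hS y).1 hy (normCoeff_eq_zero.1 ?_)
  ext m
  rcases le_total 0 m with hm | hm
  · rw [hneg y hyd m hm]; rfl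
  · rw [← normCoeff_coeff_neg_of_bar_eq hbar hmax', hneg y hyd _ (by omega)]; rfl

theorem isKazhdanLusztig_klBasis (w : W) : IsKazhdanLusztig w (klBasis cs w) :=
  (existsUnique_isKazhdanLusztig w).choose_spec.1

theorem isKazhdanLusztig_klSimple (i : B) :
    IsKazhdanLusztig (cs.simple i) (klSimple i : HeckeAlgebra cs tGen) := by
  classical
  have hs1 : (1 : W) ≠ cs.simple i := fun h => by
    simpa [← h] using cs.length_simple i
  refine ⟨?_, ?_, fun y hy n hn => ?_⟩
  · have h := bar_klSimple_mul (cs := cs) i 1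
    rwa [mul_one, ← T_one, bar_T, inv_one, T_one, Ring.inverse_one, mul_one] at h
  · rw [normCoeff, klSimple, ← T_one, map_smul, map_add, coeff_T, coeff_T, if_pos rfl, if_neg hs1,
      cs.length_simple, add_zero, smul_eq_mul, mul_one, tGen_inv_val, mul_comm, Nat.cast_one,
      T_neg_one_mul_T_one]
  · rw [normCoeff, klSimple, ← T_one, map_smul, map_add, coeff_T, coeff_T, if_neg (Ne.symm hy),
      zero_add, smul_eq_mul, tGen_inv_val]
    split_ifs with h
    · rw [← h, cs.length_one, mul_one, Nat.cast_zero, coeff_T_mul, LaurentPolynomial.T,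
        AddMonoidAlgebra.coeff_single, Finsupp.single_apply, if_neg (by omega)]
    · simp

theorem klBasis_simple (i : B) : klBasis cs (cs.simple i) = klSimple i :=
  (existsUnique_isKazhdanLusztig _).unique (isKazhdanLusztig_klBasis _)
    (isKazhdanLusztig_klSimple i)

/-! ### Specialization to `K` -/

theorem coeff_specialize (y : W) (a : HeckeAlgebra cs tGen) :
    coeff y (specialize t a) = LaurentPolynomial.eval₂ (Int.castRingHom K) t (coeff y a) :=
  rfl

theorem eval₂_tGen : LaurentPolynomial.eval₂ (Int.castRingHom K) t (tGen : ℤ[T;T⁻¹]) = t := by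
  rw [tGen_val, LaurentPolynomial.eval₂_T, zpow_one]

theorem eval₂_tGen_inv :
    LaurentPolynomial.eval₂ (Int.castRingHom K) t (↑tGen⁻¹ : ℤ[T;T⁻¹]) = (↑t⁻¹ : K) := by
  rw [tGen_inv_val, LaurentPolynomial.eval₂_T, zpow_neg_one]

theorem specialize_smul (r : ℤ[T;T⁻¹]) (a : HeckeAlgebra cs tGen) :
    specialize t (r • a) = LaurentPolynomial.eval₂ (Int.castRingHom K) t r • specialize t a := by
  ext1 y
  rw [coeff_specialize, map_smul, smul_eq_mul, map_mul, map_smul, smul_eq_mul, coeff_specialize]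

theorem specialize_T (w : W) : specialize t (T cs tGen w) = T cs t w := by
  classical
  ext1 y
  rw [coeff_specialize, coeff_T, coeff_T]
  split_ifs <;> simp

theorem specialize_T_simple_mul (i : B) (a : HeckeAlgebra cs tGen) :
    specialize t (T cs tGen (cs.simple i) * a) = T cs t (cs.simple i) * specialize t a := by
  ext1 y
  rw [coeff_specialize]
  by_cases h : cs.IsLeftDescent y i
  · rw [coeff_T_simple_mul_down h, coeff_T_simple_mul_down h, map_add, map_mul, map_sub, map_pow,
      map_one, eval₂_tGen, coeff_specialize, coeff_specialize]
  · rw [coeff_T_simple_mul_up h, coeff_T_simple_mul_up h, map_mul, map_pow, eval₂_tGen,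
      coeff_specialize]

variable (cs t) in
theorem klElement_simple (i : B) :
    klElement cs t (cs.simple i) = (↑t⁻¹ : K) • (T cs t (cs.simple i) + 1) := by
  rw [klElement, klBasis_simple, klSimple, specialize_smul, map_add, eval₂_tGen_inv, specialize_T,
    ← T_one, specialize_T, T_one]

theorem klElement_simple_mul {x : W} {i : B} (hx : cs.IsLeftDescent x i) :
    klElement cs t (cs.simple i) * klElement cs t x =
      ((t : K) + (↑t⁻¹ : K)) • klElement cs t x := by
  have h := congrArg (specialize t) (klSimple_mul_eq_smul hx (isKazhdanLusztig_klBasis x))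
  rw [specialize_smul, map_add, ← tGen_val, ← tGen_inv_val, eval₂_tGen, eval₂_tGen_inv, klSimple,
    smul_mul_assoc, add_mul, one_mul, specialize_smul, map_add, specialize_T_simple_mul,
    eval₂_tGen_inv] at h
  rw [klElement_simple, smul_mul_assoc, add_mul, one_mul]
  exact h

/-! ### Invariant forms and the left cell representation -/

theorem involution_T (w : W) : involution (T cs t w) = T cs t w⁻¹ :=
  Finsupp.mapDomain_single

/-- `C'_s` is self-adjoint for an invariant form, since `T_s^* = T_s`. -/
theorem IsInvariantForm.klElement_simple_smul {V : Type*} [AddCommGroup V] [Module K V]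
    [Module (HeckeAlgebra cs t) V] [IsScalarTower K (HeckeAlgebra cs t) V]
    {φ : LinearMap.BilinForm K V} (hφ : IsInvariantForm (cs := cs) (t := t) φ) (i : B) (v v' : V) :
    φ (klElement cs t (cs.simple i) • v) v' = φ v (klElement cs t (cs.simple i) • v') := by
  have h := hφ (cs.simple i) v v'
  rw [involution_T, cs.inv_simple] at h
  simp only [klElement_simple, smul_assoc, add_smul, one_smul, map_smul, map_add,
    LinearMap.smul_apply, LinearMap.add_apply, h]

theorem klElement_simple_smul_cellBasis {C : Set W} (x : C) {i : B}
    (hx : cs.IsLeftDescent (x : W) i) :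
    klElement cs t (cs.simple i) • cellBasis cs t x =
      ((t : K) + (↑t⁻¹ : K)) • cellBasis cs t x := by
  rw [cellBasis, ← Submodule.Quotient.mk_smul, ← Submodule.Quotient.mk_smul]
  exact congrArg _ (Subtype.ext (klElement_simple_mul hx))

end HeckeAlgebra

theorem mainTheorem11 {B W : Type*} [Group W] {M : CoxeterMatrix B} (cs : CoxeterSystem M W)
    {K : Type*} [CommRing K] (t : Kˣ) (C : Set W) (hC : HeckeAlgebra.IsLeftCell cs C)
    (φ : LinearMap.BilinForm K (HeckeAlgebra.CellModule cs t C))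
    (hsymm : φ.IsSymm) (hnondeg : φ.Nondegenerate)
    (hinv : HeckeAlgebra.IsInvariantForm (cs := cs) (t := t) φ)
    (s : B) (x w : C) (hx : cs.IsLeftDescent (x : W) s) (hw : ¬cs.IsLeftDescent (w : W) s) :
    ((t : K) + ((t⁻¹ : Kˣ) : K)) *
        φ (HeckeAlgebra.cellBasis cs t x) (HeckeAlgebra.cellBasis cs t w) =
      φ (HeckeAlgebra.cellBasis cs t x)
        (HeckeAlgebra.klElement cs t (cs.simple s) • HeckeAlgebra.cellBasis cs t w) := by
  rw [← hinv.klElement_simple_smul, HeckeAlgebra.klElement_simple_smul_cellBasis x hx, map_smul,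
    LinearMap.smul_apply, smul_eq_mul]
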